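/- For integers $1\le m\le U$ let $S=\{s_1<\dots<s_m\}\subseteq\{1,\dots,U\}$ be the random $m$-point set with \[ \Pr[S=\{s_1,\dots,s_m\}]=\frac{1}{M(U,m)}\prod_{j=0}^{m}C_{s_{j+1}-s_j-1},\qquad s_0=0,\ s_{m+1}=U+1, \] where $C_n$ is the $n$-th Catalan number and $M(U,m)$ is the normalizing constant. Let $1\le k\le m^2$ be a real number, $L=\lfloor m^2/k\rfloor$ and $K=\lfloor U/L\rfloor$, and let $\Delta$ be uniformly distributed in $\{1,\dots,L\}$, independently of $S$. Divide the integers into the intervals $[\Delta+jL,\Delta+(j+1)L)$, $j\in\mathbb{Z}$, and call an interval non-empty if it contains a point of $S$, and empty otherwise. Suppose that $U=\Theta(m^2)$, i.e. $a m^2\le U\le b m^2$ for fixed constants $a,b>0$. Then, with constants in the $O(\cdot)$ that depend only on $a$ and $b$: 1. for every real $t\ge 1$, the expected number of pairs of non-empty intervals that have no non-empty interval and between $t-1$ and $2t$ (inclusive) empty intervals in between is at most $O(\sqrt{k/t}+1)$; 2. the expected number of non-empty intervals is at most $O(\sqrt{k}+\log K)$. -/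

import Mathlib

namespace CatalanBlock

/-- The possible values of a random `m`-point subset `{s_1 < ... < s_m}` of `[1, U]`, written as
strictly increasing sequences `0 = s_0 < s_1 < ... < s_m < s_{m+1} = U + 1`. -/
def pointSeqs (U m : ℕ) : Finset (Fin (m + 2) → Fin (U + 2)) :=
  {s | StrictMono s ∧ s 0 = 0 ∧ s (Fin.last (m + 1)) = Fin.last (U + 1)}

/-- The weight `∏_{j=0}^m C_{s_{j+1} - s_j - 1}`, with `C_n` the Catalan numbers. -/
def gapWeight {U m : ℕ} (s : Fin (m + 2) → Fin (U + 2)) : ℕ :=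
  ∏ j : Fin (m + 1), catalan ((s j.succ : ℕ) - (s j.castSucc : ℕ) - 1)

/-- The normalizing constant `M(U, m)`: the total weight of all point sets. -/
def totalWeight (U m : ℕ) : ℕ :=
  ∑ s ∈ pointSeqs U m, gapWeight s

/-- The probability that the random set is the one given by `s`. -/
noncomputable def seqProb {U m : ℕ} (s : Fin (m + 2) → Fin (U + 2)) : ℝ :=
  (gapWeight s : ℝ) / (totalWeight U m : ℝ)

/-- The point set `S = {s_1, ..., s_m}` (the two sentinels `s_0` and `s_{m+1}` are left out). -/
def pointSet {U m : ℕ} (s : Fin (m + 2) → Fin (U + 2)) : Finset ℕ :=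
  Finset.univ.image fun i : Fin m => (s i.succ.castSucc : ℕ)

/-- The expectation of `f(S, Δ)`, where `S` is the random `m`-point subset of `[1, U]` with law
`seqProb` and `Δ` is uniform in `{1, ..., L}` and independent of `S`. -/
noncomputable def expect (U m L : ℕ) (f : Finset ℕ → ℕ → ℝ) : ℝ :=
  ∑ s ∈ pointSeqs U m, ∑ Δ ∈ Finset.Icc 1 L, seqProb s * (1 / (L : ℝ)) * f (pointSet s) Δ

/-- The `j`-th interval `[Δ + j L, Δ + (j + 1) L)` of the subdivision with offset `Δ`. -/
def interval (L Δ : ℕ) (j : ℤ) : Set ℤ :=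
  Set.Ico ((Δ : ℤ) + j * L) ((Δ : ℤ) + (j + 1) * L)

/-- The indices of the intervals that contain at least one point of `S`. -/
def nonemptyIntervals (L : ℕ) (S : Finset ℕ) (Δ : ℕ) : Set ℤ :=
  {j | ∃ p ∈ S, (p : ℤ) ∈ interval L Δ j}

/-- The pairs of non-empty intervals that have no non-empty interval in between and between
`t - 1` and `2 t` (both inclusive) empty ones. -/
def gapPairs (L : ℕ) (S : Finset ℕ) (Δ : ℕ) (t : ℝ) : Set (ℤ × ℤ) :=
  {p | p.1 ∈ nonemptyIntervals L S Δ ∧ p.2 ∈ nonemptyIntervals L S Δ ∧ p.1 < p.2 ∧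
    (∀ j, p.1 < j → j < p.2 → j ∉ nonemptyIntervals L S Δ) ∧
    t - 1 ≤ ((p.2 - p.1 - 1 : ℤ) : ℝ) ∧ ((p.2 - p.1 - 1 : ℤ) : ℝ) ≤ 2 * t}

/-- The cardinalities of `nonemptyIntervals` and `gapPairs` are those of finite sets. -/
theorem nonemptyIntervals_finite (L : ℕ) (S : Finset ℕ) (Δ : ℕ) :
    (nonemptyIntervals L S Δ).Finite := by
  refine (S.image fun p : ℕ => ((p : ℤ) - Δ) / L).finite_toSet.subset ?_
  rintro j ⟨p, hp, h1, h2⟩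
  simp only [Finset.coe_image, Set.mem_image, Finset.mem_coe]
  refine ⟨p, hp, ?_⟩
  have hL : (0 : ℤ) < L := by nlinarith
  rw [Int.ediv_eq_iff_of_pos hL]
  constructor <;> nlinarith

theorem gapPairs_finite (L : ℕ) (S : Finset ℕ) (Δ : ℕ) (t : ℝ) :
    (gapPairs L S Δ t).Finite :=
  ((nonemptyIntervals_finite L S Δ).prod (nonemptyIntervals_finite L S Δ)).subset
    fun _ h => ⟨h.1, h.2.1⟩

theorem catalan_pos' (n : ℕ) : 0 < catalan n := by
  have h := succ_mul_catalan_eq_centralBinom n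
  have h2 := Nat.centralBinom_pos n
  rcases Nat.eq_zero_or_pos (catalan n) with h0 | h0
  · simp [h0] at h; omega
  · exact h0

/-- For `m ≤ U` the weights can be normalized. -/
theorem totalWeight_pos {U m : ℕ} (h : m ≤ U) : 0 < totalWeight U m := by
  let s : Fin (m + 2) → Fin (U + 2) := fun i =>
    if hi : (i : ℕ) = m + 1 then Fin.last (U + 1) else ⟨i, by omega⟩
  refine Finset.sum_pos (fun s _ => Finset.prod_pos fun _ _ => catalan_pos' _) ⟨s, ?_⟩
  simp only [pointSeqs, Finset.mem_filter, Finset.mem_univ, true_and]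
  refine ⟨?_, ?_, ?_⟩
  · intro i j hij
    have hij' : (i : ℕ) < j := hij
    have hj := j.2
    simp only [s, Fin.lt_def]
    split_ifs <;> simp <;> omega
  · simp [s]
  · simp [s]

/-- For `m ≤ U` and `1 ≤ L`, `expect` is the expectation of a probability distribution. -/
theorem expect_one {U m L : ℕ} (h : m ≤ U) (hL : 1 ≤ L) :
    expect U m L (fun _ _ => 1) = 1 := by
  have h1 : (totalWeight U m : ℝ) ≠ 0 := by exact_mod_cast (totalWeight_pos h).ne'
  have h2 : (L : ℝ) ≠ 0 := by exact_mod_cast (by omega : L ≠ 0)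
  have h3 : ∑ s ∈ pointSeqs U m, seqProb s = 1 := by
    simp only [seqProb]
    rw [← Finset.sum_div, ← Nat.cast_sum]
    exact div_self h1
  simp only [expect, mul_one, Finset.sum_const, Nat.card_Icc, Nat.add_sub_cancel, nsmul_eq_mul]
  refine (Finset.sum_congr rfl fun s _ => ?_).trans h3
  field_simp

end CatalanBlock

/-! The total weight of point sets with `r` gaps and `n` points outside the set is `ballot r n =
[x^n] C(x)^r`, with `C` the Catalan series, and the ballot formula turns it into a binomial
probability. Three estimates follow: `catalan n` is `O(4^n (n+1)^(-3/2))` (`catalan_le`); `ballot m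
n` is `O(2^(2n+m) / m^2)` uniformly in `n` (`ballot_mul_sq_le`); and for `U = Θ(m^2)` the
normalizing constant attains this order (`exists_le_ballot`). Hence a fixed gap has size `n` with
probability `O((n+1)^(-3/2))`.

Consecutive non-empty intervals are separated by a single gap across which the interval index jumps.
A gap of size `n` jumps by at least `t` for at most `min(L, n+1)` of the `L` offsets, and only if `n
+ 1 > (t-1)L` (`card_crossing_le`). Summing against `(n+1)^(-3/2)` gives `O(√(L/t))`
(`sum_crossBound_le`), so the `m+1` gaps produce `O((m/L) √(L/t)) = O(√(k/t))` long jumps on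
average. This settles the pairs; `t = 1` counts all jumps at once and bounds the non-empty intervals
by `O(√k) + 1`, without a logarithm. -/

namespace CatalanBlock

/-! ### Coefficients of powers of the Catalan series. -/

open PowerSeries in
/-- The ballot formula for the coefficients of the powers of the Catalan series. -/
theorem ballot_formula (n : ℕ) : ∀ r : ℕ,
    (2 * n + r) * coeff n (catalanSeries ^ r) = r * (2 * n + r).choose n := by
  induction n with
  | zero => intro r; simp
  | succ n ihn =>
    intro r
    induction r with
    | zero => simp [coeff_one]
    | succ r ihr =>
      have hrec : coeff (n + 1) (catalanSeries ^ (r + 1)) =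
          coeff (n + 1) (catalanSeries ^ r) + coeff n (catalanSeries ^ (r + 2)) := by
        -- Multiply `C = 1 + x C^2` by `C^r`.
        have h : catalanSeries ^ (r + 1) =
            catalanSeries ^ r + catalanSeries ^ (r + 2) * (X : PowerSeries ℕ) := by
          rw [pow_succ]
          nth_rewrite 2 [← catalanSeries_sq_mul_X_add_one]
          ring
        rw [h, map_add, coeff_succ_mul_X]
      have h2 := ihn (r + 2)
      set A := coeff (n + 1) (catalanSeries ^ r)
      set B := coeff n (catalanSeries ^ (r + 2))
      have e1 : 2 * (n + 1) + (r + 1) = (2 * n + r + 2) + 1 := by ring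
      have e2 : 2 * (n + 1) + r = 2 * n + r + 2 := by ring
      have e3 : 2 * n + (r + 2) = 2 * n + r + 2 := by ring
      rw [e2] at ihr
      rw [e3] at h2
      rw [hrec, e1, Nat.choose_succ_succ' (2 * n + r + 2) n]
      have hc := Nat.choose_succ_right_eq (2 * n + r + 2) n
      have e4 : 2 * n + r + 2 - n = n + r + 2 := by omega
      rw [e4] at hc
      set x := (2 * n + r + 2).choose (n + 1)
      set y := (2 * n + r + 2).choose n
      have hT : 0 < 2 * n + r + 2 := by omega
      apply Nat.eq_of_mul_eq_mul_left hT
      zify at *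
      linear_combination (2 * (n : ℤ) + r + 2 + 1) * (ihr + h2) - 2 * hc

/-! ### Binomial probabilities: Gaussian-type bounds. -/

/-- The binomial probability of `n` successes in `2 n + r` fair coin tosses. -/
noncomputable def coinProb (r n : ℕ) : ℝ := ((2 * n + r).choose n : ℝ) / 2 ^ (2 * n + r)

theorem coinProb_pos (r n : ℕ) : 0 < coinProb r n := by
  have : 0 < (2 * n + r).choose n := Nat.choose_pos (by omega)
  unfold coinProb
  positivity

/-- Both sides have `2n + r + 2` tosses. Induction on `r` in steps of two thus moves along one row
of Pascal's triangle, from the centre (`r = 0` or `1`) outwards. -/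
theorem coinProb_step (r n : ℕ) :
    coinProb (r + 2) n * (n + r + 2) = coinProb r (n + 1) * (n + 1) := by
  unfold coinProb
  have e2 : 2 * (n + 1) + r = 2 * n + r + 2 := by ring
  have e3 : 2 * n + (r + 2) = 2 * n + r + 2 := by ring
  rw [e2, e3]
  have hc := Nat.choose_succ_right_eq (2 * n + r + 2) n
  have e4 : 2 * n + r + 2 - n = n + r + 2 := by omega
  rw [e4] at hc
  have hc' : ((2 * n + r + 2).choose (n + 1) : ℝ) * (n + 1) =
      (2 * n + r + 2).choose n * (n + r + 2) := by exact_mod_cast hc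
  rw [div_mul_eq_mul_div, div_mul_eq_mul_div, hc']

theorem coinProb_one (n : ℕ) : coinProb 1 n = coinProb 0 (n + 1) := by
  unfold coinProb
  have h := Nat.choose_succ_succ' (2 * n + 1) n
  have h' : (2 * n + 1).choose (n + 1) = (2 * n + 1).choose n := Nat.choose_symm_half n
  have e : 2 * (n + 1) + 0 = 2 * n + 1 + 1 := by ring
  rw [e, h, h', pow_succ _ (2 * n + 1)]
  push_cast
  field_simp
  ring

theorem coinProb_zero_succ (n : ℕ) :
    coinProb 0 (n + 1) * (2 * (n + 1)) = coinProb 0 n * (2 * n + 1) := by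
  unfold coinProb
  have h := Nat.succ_mul_centralBinom_succ n
  rw [Nat.centralBinom_eq_two_mul_choose, Nat.centralBinom_eq_two_mul_choose] at h
  have h' : ((n : ℝ) + 1) * (2 * (n + 1)).choose (n + 1) = 2 * (2 * n + 1) * (2 * n).choose n := by
    exact_mod_cast h
  have e : (2 : ℝ) ^ (2 * (n + 1)) = 4 * 2 ^ (2 * n) := by ring
  simp only [add_zero]
  rw [e]
  field_simp
  linear_combination 2 * h'

/-- The left side is nonincreasing in `n`, as `(2n+1)(2n+3) ≤ (2n+2)^2`. -/
theorem coinProb_zero_sq_le (n : ℕ) : coinProb 0 n ^ 2 * (2 * n + 1) ≤ 1 := by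
  induction n with
  | zero => simp [coinProb]
  | succ n ih =>
    have h := coinProb_zero_succ n
    set x := coinProb 0 n
    set y := coinProb 0 (n + 1)
    have hn : (0 : ℝ) ≤ n := n.cast_nonneg
    have hy : y = x * (2 * n + 1) / (2 * (n + 1)) := by field_simp; linear_combination h
    have hr : (2 * (n : ℝ) + 1) * (2 * n + 3) / (2 * (n + 1)) ^ 2 ≤ 1 := by
      rw [div_le_one (by positivity)]
      nlinarith
    calc y ^ 2 * (2 * ((n + 1 : ℕ) : ℝ) + 1)
        = (x ^ 2 * (2 * n + 1)) * ((2 * (n : ℝ) + 1) * (2 * n + 3) / (2 * (n + 1)) ^ 2) := by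
          rw [hy]; push_cast; field_simp; ring
      _ ≤ 1 := mul_le_one₀ ih (by positivity) hr

theorem one_le_coinProb_zero_sq (n : ℕ) : 1 ≤ coinProb 0 (n + 1) ^ 2 * (4 * (n + 1)) := by
  induction n with
  | zero => norm_num [coinProb]
  | succ n ih =>
    have h := coinProb_zero_succ (n + 1)
    set x := coinProb 0 (n + 1)
    set y := coinProb 0 (n + 1 + 1)
    push_cast at *
    have hn : (0 : ℝ) ≤ n := n.cast_nonneg
    have hy : y = x * (2 * (n + 1) + 1) / (2 * (n + 1 + 1)) := by field_simp; linear_combination h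
    have hr : 1 ≤ (2 * ((n : ℝ) + 1) + 1) ^ 2 / (4 * (n + 1) * (n + 1 + 1)) := by
      rw [one_le_div (by positivity)]
      nlinarith
    calc (1 : ℝ) ≤ (x ^ 2 * (4 * (n + 1))) *
          ((2 * ((n : ℝ) + 1) + 1) ^ 2 / (4 * (n + 1) * (n + 1 + 1))) := one_le_mul_of_one_le_of_one_le ih hr
      _ = _ := by rw [hy]; field_simp; ring

/-- A rational substitute for the Gaussian tail. With `T` tosses and `r^2 ≫ T`, the fourth power
still yields `coinProb r n = O(T / r^3)`, just what `ballot_mul_sq_le` needs. -/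
theorem coinProb_sq_mul_le : ∀ r n : ℕ,
    coinProb r n ^ 2 * (2 * n + r + (r : ℝ) ^ 2 / 8) ^ 4 ≤ (2 * n + r + 1) ^ 3
  | 0, n => by
    have h := coinProb_zero_sq_le n
    have hn : (0 : ℝ) ≤ n := n.cast_nonneg
    simp only [Nat.cast_zero, add_zero]
    calc coinProb 0 n ^ 2 * (2 * n + 0 ^ 2 / 8 : ℝ) ^ 4
        ≤ coinProb 0 n ^ 2 * (2 * n + 1 : ℝ) ^ 4 := by gcongr; norm_num
      _ = (coinProb 0 n ^ 2 * (2 * n + 1)) * (2 * n + 1) ^ 3 := by ring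
      _ ≤ 1 * (2 * n + 1) ^ 3 := by gcongr
      _ = _ := by ring
  | 1, n => by
    have h := coinProb_zero_sq_le (n + 1)
    rw [← coinProb_one] at h
    have hn : (0 : ℝ) ≤ n := n.cast_nonneg
    push_cast at *
    calc coinProb 1 n ^ 2 * (2 * n + 1 + 1 ^ 2 / 8 : ℝ) ^ 4
        ≤ coinProb 1 n ^ 2 * ((2 * (n + 1) + 1) * (2 * n + 1 + 1) ^ 3 : ℝ) := by
          gcongr
          rw [pow_succ, mul_comm]
          gcongr ?_ * ?_ ^ 3 <;> linarith
      _ = (coinProb 1 n ^ 2 * (2 * (n + 1) + 1)) * (2 * n + 1 + 1) ^ 3 := by ring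
      _ ≤ 1 * (2 * n + 1 + 1) ^ 3 := by gcongr
      _ = _ := by ring
  | r + 2, n => by
    have ih := coinProb_sq_mul_le r (n + 1)
    have hs := coinProb_step r n
    have hn : (0 : ℝ) ≤ n := n.cast_nonneg
    have hr : (0 : ℝ) ≤ r := r.cast_nonneg
    have hx := coinProb_pos r (n + 1)
    set x := coinProb r (n + 1)
    have hy : coinProb (r + 2) n = x * ((n + 1) / (n + r + 2)) := by
      field_simp; linear_combination hs
    rw [hy]
    push_cast at *
    have key : ((n : ℝ) + 1) / (n + r + 2) * (2 * n + (r + 2) + (r + 2 : ℝ) ^ 2 / 8) ^ 2 ≤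
        (2 * (n + 1) + r + (r : ℝ) ^ 2 / 8) ^ 2 := by
      rw [div_mul_eq_mul_div, div_le_iff₀ (by positivity)]
      set P : ℝ := 2 * (n + 1) + r + (r : ℝ) ^ 2 / 8 with hP
      -- The number of tosses is unchanged and `(r+2)^2/8 - r^2/8 = (r+1)/2`.
      have e : (2 * n + (r + 2) + (r + 2 : ℝ) ^ 2 / 8) = P + (r + 1) / 2 := by rw [hP]; ring
      rw [e]
      have hP0 : 0 ≤ (r : ℝ) ^ 2 / 8 := by positivity
      have h1 : 2 * ((n : ℝ) + 1) ≤ P := by linarith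
      have h2 : ((r : ℝ) + 1) / 2 ≤ 2 * P := by linarith
      have h4 : (2 * ((n : ℝ) + 1)) * (P * (r + 1) + ((r + 1) / 2) ^ 2) ≤
          P * (P * (r + 1) + ((r + 1) / 2) * (2 * P)) := by
        rw [sq ((r + 1 : ℝ) / 2)]
        have hP' : 0 ≤ P := by linarith
        gcongr
      linarith
    calc (x * ((n + 1) / (n + r + 2))) ^ 2 * (2 * n + (r + 2) + (r + 2 : ℝ) ^ 2 / 8) ^ 4
        = x ^ 2 * (((n : ℝ) + 1) / (n + r + 2) * (2 * n + (r + 2) + (r + 2 : ℝ) ^ 2 / 8) ^ 2) ^ 2 := by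
          ring
      _ ≤ x ^ 2 * ((2 * (n + 1) + r + (r : ℝ) ^ 2 / 8) ^ 2) ^ 2 := by gcongr
      _ = x ^ 2 * (2 * (n + 1) + r + (r : ℝ) ^ 2 / 8) ^ 4 := by ring
      _ ≤ _ := ih
      _ = _ := by ring

/-- Each outward step multiplies the probability by `1/(1 + (r+1)/(n+1)) ≥ exp(-(r+1)/(n+1))`;
squared, this fits into the increment `(r+2)^2 - r^2` of the exponent. -/
theorem exp_le_coinProb_sq : ∀ r n : ℕ,
    Real.exp (-((r : ℝ) ^ 2 / (n + 1))) ≤ coinProb r n ^ 2 * (2 * (2 * n + r + 1))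
  | 0, n => by
    rcases n with _ | n
    · norm_num [coinProb]
    · have h := one_le_coinProb_zero_sq n
      have hx := coinProb_pos 0 (n + 1)
      push_cast
      norm_num
      nlinarith [sq_nonneg (coinProb 0 (n + 1))]
  | 1, n => by
    have h := one_le_coinProb_zero_sq n
    rw [← coinProb_one] at h
    have h1 : Real.exp (-(((1 : ℕ) : ℝ) ^ 2 / (n + 1))) ≤ 1 :=
      Real.exp_le_one_iff.2 (neg_nonpos.2 (by positivity))
    push_cast at *
    linarith
  | r + 2, n => by
    have ih := exp_le_coinProb_sq r (n + 1)
    have hs := coinProb_step r n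
    have hn : (0 : ℝ) ≤ n := n.cast_nonneg
    have hr : (0 : ℝ) ≤ r := r.cast_nonneg
    have hx := coinProb_pos r (n + 1)
    set x := coinProb r (n + 1)
    have hy : coinProb (r + 2) n = x * ((n + 1) / (n + r + 2)) := by
      field_simp; linear_combination hs
    rw [hy]
    push_cast at *
    have h1 : Real.exp (-((r + 1 : ℝ) / (n + 1))) ≤ (n + 1) / (n + r + 2) := by
      rw [Real.exp_neg, inv_le_comm₀ (Real.exp_pos _) (by positivity), inv_div]
      refine le_trans (le_of_eq ?_) (Real.add_one_le_exp _)
      field_simp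
      ring
    have h2 : Real.exp (-((r + 2 : ℝ) ^ 2 / (n + 1))) ≤
        Real.exp (-((r : ℝ) ^ 2 / (n + 1 + 1))) * Real.exp (-((r + 1 : ℝ) / (n + 1))) ^ 2 := by
      rw [← Real.exp_nat_mul, ← Real.exp_add, Real.exp_le_exp]
      have : (r : ℝ) ^ 2 / (n + 1 + 1) ≤ (r : ℝ) ^ 2 / (n + 1) := by gcongr; linarith
      have h3 : (r : ℝ) ^ 2 / (n + 1) + 2 * ((r + 1 : ℝ) / (n + 1)) ≤ (r + 2 : ℝ) ^ 2 / (n + 1) := by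
        rw [← mul_div_assoc, ← add_div]
        gcongr
        nlinarith
      push_cast
      linarith
    calc Real.exp (-((r + 2 : ℝ) ^ 2 / (n + 1)))
        ≤ _ := h2
      _ ≤ (x ^ 2 * (2 * (2 * (n + 1) + r + 1))) * ((n + 1) / (n + r + 2)) ^ 2 := by gcongr
      _ = _ := by ring

/-! ### Bounds for the ballot weights and the normalizing constant. -/

/-- The weight `[x^n] C(x)^r`, with `C` the Catalan series. -/
noncomputable def ballot (r n : ℕ) : ℝ :=
  (PowerSeries.coeff n (PowerSeries.catalanSeries ^ r) : ℕ)

theorem ballot_mul (r n : ℕ) :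
    (2 * n + r) * ballot r n = r * coinProb r n * 2 ^ (2 * n + r) := by
  have h : ((2 * n + r : ℕ) : ℝ) * ballot r n = r * ((2 * n + r).choose n : ℕ) := by
    unfold ballot
    exact_mod_cast ballot_formula n r
  push_cast at h
  rw [h, coinProb, mul_assoc, div_mul_cancel₀ _ (by positivity)]

/-- The normalized weight is `r * coinProb r n / T` with `T = 2n + r`, so `coinProb r n * r^3 ≤ 64
T` suffices. Uniformity in `n` matters: conditioning on one gap leaves an arbitrary total for the
others. -/
theorem ballot_mul_sq_le (r n : ℕ) : ballot r n * r ^ 2 ≤ 64 * 2 ^ (2 * n + r) := by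
  rcases Nat.eq_zero_or_pos r with rfl | hr
  · simp
  have h := coinProb_sq_mul_le r n
  have hb := ballot_mul r n
  have hx := coinProb_pos r n
  set x := coinProb r n
  have hr1 : (1 : ℝ) ≤ r := by exact_mod_cast hr
  have hn : (0 : ℝ) ≤ n := n.cast_nonneg
  set T : ℝ := 2 * n + r with hT
  have hT1 : 1 ≤ T := by linarith
  have h1 : T * ((r : ℝ) ^ 2 / 8) ^ 3 ≤ (T + (r : ℝ) ^ 2 / 8) ^ 4 := by
    have hq : 0 ≤ (r : ℝ) ^ 2 / 8 := by positivity
    generalize (r : ℝ) ^ 2 / 8 = q at hq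
    calc T * q ^ 3 ≤ (T + q) * (T + q) ^ 3 := by gcongr <;> linarith
      _ = _ := by ring
  have h2 : x ^ 2 * (T * ((r : ℝ) ^ 2 / 8) ^ 3) ≤ (2 * T) ^ 3 :=
    calc _ ≤ x ^ 2 * (T + (r : ℝ) ^ 2 / 8) ^ 4 := by gcongr
      _ ≤ (T + 1) ^ 3 := h
      _ ≤ _ := by gcongr; linarith
  -- `64^2 = 8^3 * 2^3`, from `r^2/8` cubed and `T + 1 ≤ 2T` cubed.
  have h3 : (x * r ^ 3) ^ 2 ≤ (64 * T) ^ 2 := by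
    have hT0 : 0 < T := by linarith
    refine le_of_mul_le_mul_left ?_ hT0
    nlinarith
  have h4 : x * r ^ 3 ≤ 64 * T := (sq_le_sq₀ (by positivity) (by positivity)).1 h3
  have hT0 : 0 < T := by linarith
  refine le_of_mul_le_mul_left ?_ hT0
  calc T * (ballot r n * r ^ 2) = (T * ballot r n) * r ^ 2 := by ring
    _ = (x * r ^ 3) * 2 ^ (2 * n + r) := by rw [hb]; ring
    _ ≤ (64 * T) * 2 ^ (2 * n + r) := by gcongr
    _ = _ := by ring

theorem catalan_le (n : ℕ) :
    (catalan n : ℝ) ≤ 2 ^ (2 * n + 1) / ((n + 1) * Real.sqrt (n + 1)) := by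
  have hb := ballot_mul 1 n
  have e : ballot 1 n = catalan n := by simp [ballot]
  have h := coinProb_zero_sq_le (n + 1)
  rw [← coinProb_one] at h
  rw [e] at hb
  have hx := coinProb_pos 1 n
  set x := coinProb 1 n
  have hn : (0 : ℝ) ≤ n := n.cast_nonneg
  push_cast at *
  have hs : 0 < Real.sqrt ((n : ℝ) + 1) := Real.sqrt_pos.2 (by linarith)
  have h1 : x * Real.sqrt (n + 1) ≤ 1 := by
    refine (abs_le_one_iff_mul_self_le_one.2 ?_ |> le_of_abs_le)
    have := Real.mul_self_sqrt (show (0 : ℝ) ≤ n + 1 by linarith)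
    calc x * √(n + 1) * (x * √(n + 1)) = x ^ 2 * (√(n + 1) * √(n + 1)) := by ring
      _ = x ^ 2 * (n + 1) := by rw [this]
      _ ≤ x ^ 2 * (2 * (n + 1) + 1) := by gcongr; linarith
      _ ≤ 1 := h
  rw [le_div_iff₀ (by positivity)]
  calc (catalan n : ℝ) * ((n + 1) * √(n + 1)) ≤ (catalan n : ℝ) * ((2 * n + 1) * √(n + 1)) := by
        gcongr; linarith
    _ = ((2 * n + 1) * catalan n) * √(n + 1) := by ring
    _ = (x * √(n + 1)) * 2 ^ (2 * n + 1) := by rw [hb]; ring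
    _ ≤ 1 * 2 ^ (2 * n + 1) := by gcongr
    _ = _ := one_mul _

/-- In the regime `U = Θ(m^2)` the normalizing constant has the expected order. -/
theorem exists_le_ballot (a b : ℝ) (ha : 0 < a) (hb : 0 < b) :
    ∃ c : ℝ, 0 < c ∧ ∀ m U : ℕ, 1 ≤ m → m ≤ U → a * (m : ℝ) ^ 2 ≤ U → (U : ℝ) ≤ b * (m : ℝ) ^ 2 →
      c * 2 ^ (2 * (U - m) + (m + 1)) ≤ ballot (m + 1) (U - m) * m ^ 2 := by
  set ρ : ℝ := 2 / a + 4 / a ^ 2 with hρ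
  set c₀ : ℝ := Real.exp (-(4 * ρ)) / (2 * (2 * b + 1)) with hc₀
  have hc₀' : 0 < c₀ := by positivity
  refine ⟨Real.sqrt c₀ / (2 * b), by positivity, ?_⟩
  intro m U hm hmU h1 h2
  have hm1 : (1 : ℝ) ≤ m := by exact_mod_cast hm
  obtain ⟨n, rfl⟩ := Nat.exists_eq_add_of_le hmU
  rw [Nat.add_sub_cancel_left]
  push_cast at h1 h2
  have hn : (0 : ℝ) ≤ n := n.cast_nonneg
  have hx := coinProb_pos (m + 1) n
  have he := exp_le_coinProb_sq (m + 1) n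
  have hbal := ballot_mul (m + 1) n
  set x := coinProb (m + 1) n
  -- If `m a ≥ 2`, then `n = U - m ≥ a m^2 / 2`; otherwise `m < 2/a` is bounded. The two summands of
  -- `ρ` serve these cases.
  have hmn : (m : ℝ) ^ 2 ≤ ρ * (n + 1) := by
    have hρ1 : 0 ≤ 2 / a := by positivity
    have hρ2 : 0 ≤ 4 / a ^ 2 := by positivity
    rcases le_or_gt 2 (m * a) with h | h
    · have : (m : ℝ) ^ 2 ≤ 2 / a * (n + 1) := by
        rw [div_mul_eq_mul_div, le_div_iff₀ ha]
        nlinarith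
      nlinarith
    · have : (m : ℝ) ^ 2 ≤ 4 / a ^ 2 := by
        rw [le_div_iff₀ (by positivity)]
        have : 0 ≤ m * a := by positivity
        nlinarith
      nlinarith
  have hexp : Real.exp (-(4 * ρ)) ≤ Real.exp (-(((m + 1 : ℕ) : ℝ) ^ 2 / (n + 1))) := by
    rw [Real.exp_le_exp, neg_le_neg_iff, div_le_iff₀ (by positivity)]
    push_cast
    nlinarith
  push_cast at *
  have hT : 2 * (n : ℝ) + (m + 1) ≤ 2 * b * m ^ 2 := by nlinarith
  have hT0 : 0 < 2 * (n : ℝ) + (m + 1) := by positivity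
  have hx2 : Real.sqrt c₀ ≤ x * m := by
    rw [Real.sqrt_le_left (by positivity), hc₀, div_le_iff₀ (by positivity)]
    calc _ ≤ _ := hexp
      _ ≤ _ := he
      _ ≤ x ^ 2 * (2 * (2 * b * m ^ 2 + m ^ 2)) := by gcongr; nlinarith
      _ = _ := by ring
  have hc1 : Real.sqrt c₀ / (2 * b) * (2 * (n : ℝ) + (m + 1)) ≤ (m + 1) * x * m ^ 2 := by
    calc Real.sqrt c₀ / (2 * b) * (2 * (n : ℝ) + (m + 1))
        ≤ Real.sqrt c₀ / (2 * b) * (2 * b * m ^ 2) := by gcongr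
      _ = Real.sqrt c₀ * m ^ 2 := by field_simp
      _ ≤ (x * m) * m ^ 2 := by gcongr
      _ = (m * x) * m ^ 2 := by ring
      _ ≤ _ := by gcongr; linarith
  refine le_of_mul_le_mul_left ?_ hT0
  calc (2 * (n : ℝ) + (m + 1)) * (√c₀ / (2 * b) * 2 ^ (2 * n + (m + 1)))
      = (√c₀ / (2 * b) * (2 * (n : ℝ) + (m + 1))) * 2 ^ (2 * n + (m + 1)) := by ring
    _ ≤ ((m + 1) * x * m ^ 2) * 2 ^ (2 * n + (m + 1)) := by gcongr
    _ = _ := by linear_combination (-(m : ℝ) ^ 2) * hbal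

end CatalanBlock

/-! ### Point sets as sequences of gaps. -/

namespace CatalanBlock

/-- The position of the `i`-th point of the set whose gaps have sizes `l j`. -/
def gapPosition {m : ℕ} (l : Fin (m + 1) → ℕ) (i : Fin (m + 2)) : ℕ :=
  ∑ j with j.castSucc < i, (l j + 1)

theorem gapPosition_zero {m : ℕ} (l : Fin (m + 1) → ℕ) : gapPosition l 0 = 0 := by
  simp [gapPosition]

theorem gapPosition_succ {m : ℕ} (l : Fin (m + 1) → ℕ) (j : Fin (m + 1)) :
    gapPosition l j.succ = gapPosition l j.castSucc + (l j + 1) := by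
  have h : (Finset.univ.filter fun i : Fin (m + 1) => i.castSucc < j.succ) =
      insert j (Finset.univ.filter fun i : Fin (m + 1) => i.castSucc < j.castSucc) := by
    ext i
    simp only [Finset.mem_filter, Finset.mem_univ, true_and, Finset.mem_insert, Fin.lt_def,
      Fin.val_castSucc, Fin.val_succ, Fin.ext_iff]
    omega
  rw [gapPosition, h, Finset.sum_insert (by simp), add_comm, gapPosition]

theorem gapPosition_last {m : ℕ} (l : Fin (m + 1) → ℕ) :
    gapPosition l (Fin.last (m + 1)) = ∑ j, l j + (m + 1) := by
  simp [gapPosition, Fin.castSucc_lt_last, Finset.sum_add_distrib]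

theorem strictMono_gapPosition {m : ℕ} (l : Fin (m + 1) → ℕ) : StrictMono (gapPosition l) := by
  rw [Fin.strictMono_iff_lt_succ]
  intro i
  rw [gapPosition_succ]
  omega

/-- The sizes of the gaps of a point set. -/
def gaps {U m : ℕ} (s : Fin (m + 2) → Fin (U + 2)) (j : Fin (m + 1)) : ℕ :=
  (s j.succ : ℕ) - (s j.castSucc : ℕ) - 1

theorem gapPosition_gaps {U m : ℕ} {s : Fin (m + 2) → Fin (U + 2)} (hs : s ∈ pointSeqs U m)
    (i : Fin (m + 2)) : gapPosition (gaps s) i = s i := by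
  simp only [pointSeqs, Finset.mem_filter, Finset.mem_univ, true_and] at hs
  induction i using Fin.induction with
  | zero => simp [gapPosition_zero, hs.2.1]
  | succ j ih =>
    have h : (s j.castSucc : ℕ) < s j.succ := hs.1 (Fin.castSucc_lt_succ)
    rw [gapPosition_succ, ih, gaps]
    omega

open PowerSeries in
/-- Sums over point sets of products over their gaps are coefficients of products. -/
theorem sum_pointSeqs_prod {U m : ℕ} (h : m ≤ U) (w : Fin (m + 1) → ℕ → ℝ) :
    ∑ s ∈ pointSeqs U m, ∏ j, w j (gaps s j) = coeff (U - m) (∏ j, PowerSeries.mk (w j)) := by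
  classical
  rw [coeff_prod]
  simp only [coeff_mk]
  -- Gap sequences are exactly the compositions of `U - m` into `m + 1` nonnegative parts;
  -- `gapPosition` inverts `gaps`.
  refine Finset.sum_bij (fun s _ => Finsupp.equivFunOnFinite.symm (gaps s)) ?_ ?_ ?_ ?_
  · intro s hs
    have h1 := gapPosition_gaps hs (Fin.last (m + 1))
    simp only [pointSeqs, Finset.mem_filter, Finset.mem_univ, true_and] at hs
    rw [gapPosition_last, hs.2.2, Fin.val_last] at h1
    simp only [Finset.mem_finsuppAntidiag, Finsupp.equivFunOnFinite_symm_apply_apply,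
      Finset.subset_univ, and_true]
    omega
  · intro s hs s' hs' he
    have he' : gaps s = gaps s' := Finsupp.equivFunOnFinite.symm.injective he
    funext i
    ext
    rw [← gapPosition_gaps hs, ← gapPosition_gaps hs', he']
  · intro l hl
    simp only [Finset.mem_finsuppAntidiag, Finset.subset_univ, and_true] at hl
    have hlast : gapPosition l (Fin.last (m + 1)) = U + 1 := by
      rw [gapPosition_last]
      have : ∑ j, l j = U - m := hl
      omega
    have hmono := strictMono_gapPosition l
    refine ⟨fun i => ⟨gapPosition l i, ?_⟩, ?_, ?_⟩
    · have := hmono.monotone (Fin.le_last i)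
      omega
    · simp only [pointSeqs, Finset.mem_filter, Finset.mem_univ, true_and]
      refine ⟨fun i j hij => hmono hij, ?_, ?_⟩
      · ext; simp [gapPosition_zero]
      · ext; simp [hlast]
    · ext j
      simp only [Finsupp.equivFunOnFinite_symm_apply_apply, gaps, gapPosition_succ]
      omega
  · intro s _
    rfl

/-! ### From non-empty intervals to long jumps. -/

/-- Two different non-empty intervals with no non-empty one in between come from two
consecutive points. -/
theorem exists_consecutive {m : ℕ} {J : Fin (m + 2) → ℤ} (hJ : Monotone J) {i i' : Fin (m + 2)}
    (hi' : i' ≠ Fin.last (m + 1)) (hlt : J i < J i')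
    (hno : ∀ l, l ≠ 0 → l ≠ Fin.last (m + 1) → J i < J l → ¬ J l < J i') :
    ∃ j : Fin (m + 1), J j.castSucc = J i ∧ J j.succ = J i' := by
  obtain ⟨j, hj1, hj2⟩ : ∃ j : Fin (m + 1), J j.castSucc ≤ J i ∧ J i < J j.succ := by
    by_contra! hcon
    have : ∀ l, J l ≤ J i := by
      intro l
      induction l using Fin.induction with
      | zero => exact hJ (Fin.zero_le _)
      | succ j ih => exact hcon j ih
    exact absurd (this i') (not_le.2 hlt)
  have h1 : i ≤ j.castSucc := by
    have : i < j.succ := hJ.reflect_lt hj2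
    exact Fin.le_castSucc_iff.2 this
  have h2 : j.succ ≤ i' := by
    have : j.castSucc < i' := hJ.reflect_lt (hj1.trans_lt hlt)
    exact Fin.castSucc_lt_iff_succ_le.1 this
  -- The sentinels do not make an interval non-empty, so `hno` needs `j.succ` to be a genuine point;
  -- `j.succ ≤ i'` rules out the last index.
  refine ⟨j, le_antisymm hj1 (hJ h1), le_antisymm (hJ h2) (not_lt.1 (hno j.succ ?_ ?_ hj2))⟩
  · exact Fin.succ_ne_zero j
  · exact fun h => hi' (le_antisymm (Fin.le_last _) (h ▸ h2))

theorem mem_insert_jumps {m : ℕ} {J : Fin (m + 2) → ℤ} (hJ : Monotone J) (i : Fin (m + 2)) :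
    J i ∈ insert (J 0) ((Finset.univ.filter fun j : Fin (m + 1) =>
      J j.castSucc < J j.succ).image fun j => J j.succ) := by
  induction i using Fin.induction with
  | zero => simp
  | succ j ih =>
    rcases (hJ (Fin.castSucc_lt_succ (i := j)).le).eq_or_lt with h | h
    · rwa [← h]
    · exact Finset.mem_insert_of_mem (Finset.mem_image_of_mem _ (by simpa using h))

theorem mem_interval_iff {L : ℕ} (hL : 0 < L) (Δ p : ℕ) (j : ℤ) :
    (p : ℤ) ∈ interval L Δ j ↔ ((p : ℤ) - Δ) / L = j := by
  have hL' : (0 : ℤ) < L := by exact_mod_cast hL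
  rw [Int.ediv_eq_iff_of_pos hL', interval, Set.mem_Ico]
  constructor <;> rintro ⟨h1, h2⟩ <;> constructor <;> linarith

theorem mem_pointSet_iff {U m : ℕ} (s : Fin (m + 2) → Fin (U + 2)) (p : ℕ) :
    p ∈ pointSet s ↔ ∃ i, i ≠ 0 ∧ i ≠ Fin.last (m + 1) ∧ (s i : ℕ) = p := by
  simp only [pointSet, Finset.mem_image, Finset.mem_univ, true_and]
  constructor
  · rintro ⟨i, rfl⟩
    refine ⟨_, ?_, ?_, rfl⟩
    · simp [Fin.ext_iff]
    · have := i.2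
      simp only [ne_eq, Fin.ext_iff, Fin.val_castSucc, Fin.val_succ, Fin.val_last]
      omega
  · rintro ⟨i, h0, h1, rfl⟩
    obtain ⟨k, rfl⟩ := Fin.exists_castSucc_eq.2 h1
    have hk : k ≠ 0 := fun h => h0 (by simp [h])
    obtain ⟨l, rfl⟩ := Fin.exists_succ_eq.2 hk
    exact ⟨l, rfl⟩

/-- The index of the interval that contains `p`. -/
def intervalIndex (L Δ p : ℕ) : ℤ := ((p : ℤ) - Δ) / L

theorem intervalIndex_mono {L : ℕ} (hL : 0 < L) (Δ : ℕ) : Monotone (intervalIndex L Δ) := by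
  intro p q h
  have hL' : (0 : ℤ) < L := by exact_mod_cast hL
  refine Int.ediv_le_ediv hL' ?_
  have : (p : ℤ) ≤ q := by exact_mod_cast h
  linarith

theorem mem_nonemptyIntervals_iff {L U m : ℕ} (hL : 0 < L) (s : Fin (m + 2) → Fin (U + 2))
    (Δ : ℕ) (j : ℤ) : j ∈ nonemptyIntervals L (pointSet s) Δ ↔
      ∃ i, i ≠ 0 ∧ i ≠ Fin.last (m + 1) ∧ intervalIndex L Δ (s i) = j := by
  simp only [nonemptyIntervals, Set.mem_ofPred_eq, mem_interval_iff hL, mem_pointSet_iff,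
    intervalIndex]
  constructor
  · rintro ⟨_, ⟨i, h0, h1, rfl⟩, h⟩
    exact ⟨i, h0, h1, h⟩
  · rintro ⟨i, h0, h1, h⟩
    exact ⟨_, ⟨i, h0, h1, rfl⟩, h⟩

open Classical in
/-- The gaps of the point set across which the index of the interval grows by at least `t`. -/
noncomputable def longJumps {U m : ℕ} (L Δ : ℕ) (t : ℝ) (s : Fin (m + 2) → Fin (U + 2)) :
    Finset (Fin (m + 1)) :=
  {j | t ≤ ((intervalIndex L Δ (s j.succ) - intervalIndex L Δ (s j.castSucc) : ℤ) : ℝ)}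

theorem monotone_index {L U m : ℕ} (hL : 0 < L) (Δ : ℕ) {s : Fin (m + 2) → Fin (U + 2)}
    (hs : s ∈ pointSeqs U m) : Monotone fun i => intervalIndex L Δ (s i) := by
  simp only [pointSeqs, Finset.mem_filter, Finset.mem_univ, true_and] at hs
  exact fun i j hij => intervalIndex_mono hL Δ (hs.1.monotone hij)

theorem ncard_gapPairs_le {L U m : ℕ} (hL : 0 < L) (Δ : ℕ) (t : ℝ)
    {s : Fin (m + 2) → Fin (U + 2)} (hs : s ∈ pointSeqs U m) :
    (gapPairs L (pointSet s) Δ t).ncard ≤ (longJumps L Δ t s).card := by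
  classical
  have hJ := monotone_index hL Δ hs
  set J := fun i => intervalIndex L Δ (s i) with hJdef
  have hsub : gapPairs L (pointSet s) Δ t ⊆
      ((longJumps L Δ t s).image fun j => (J j.castSucc, J j.succ) : Finset (ℤ × ℤ)) := by
    rintro ⟨p, q⟩ ⟨hp, hq, hlt, hno, ht, -⟩
    simp only [mem_nonemptyIntervals_iff hL] at hp hq hno
    obtain ⟨i, -, -, rfl⟩ := hp
    obtain ⟨i', -, hi', rfl⟩ := hq
    obtain ⟨j, h1, h2⟩ := exists_consecutive hJ hi' hlt
      fun l h0 h1 h2 h3 => hno _ h2 h3 ⟨l, h0, h1, rfl⟩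
    simp only [Finset.coe_image, Set.mem_image, Finset.mem_coe]
    refine ⟨j, ?_, by rw [h1, h2]⟩
    simp only [longJumps, Finset.mem_filter, Finset.mem_univ, true_and]
    simp only [hJdef] at h1 h2
    rw [h1, h2]
    push_cast at ht ⊢
    -- At least `t - 1` intervals strictly in between mean an index increase of at least `t`.
    linarith
  calc _ ≤ _ := Set.ncard_le_ncard hsub (Finset.finite_toSet _)
    _ = _ := Set.ncard_coe_finset _
    _ ≤ _ := Finset.card_image_le

/-- Every index taken is the target of a jump or the index of the sentinel `s_0`; the latter costs
the `+ 1`. -/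
theorem ncard_nonemptyIntervals_le {L U m : ℕ} (hL : 0 < L) (Δ : ℕ)
    {s : Fin (m + 2) → Fin (U + 2)} (hs : s ∈ pointSeqs U m) :
    (nonemptyIntervals L (pointSet s) Δ).ncard ≤ (longJumps L Δ 1 s).card + 1 := by
  classical
  have hJ := monotone_index hL Δ hs
  have hjump : longJumps L Δ 1 s = Finset.univ.filter fun j : Fin (m + 1) =>
      intervalIndex L Δ (s j.castSucc) < intervalIndex L Δ (s j.succ) := by
    ext j
    simp only [longJumps, Finset.mem_filter, Finset.mem_univ, true_and]
    rw [← Int.cast_one, Int.cast_le]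
    omega
  have hsub : nonemptyIntervals L (pointSet s) Δ ⊆ (insert (intervalIndex L Δ (s 0))
      ((longJumps L Δ 1 s).image fun j => intervalIndex L Δ (s j.succ)) : Finset ℤ) := by
    intro p hp
    obtain ⟨i, -, -, rfl⟩ := (mem_nonemptyIntervals_iff hL s Δ p).1 hp
    rw [hjump]
    exact mem_insert_jumps hJ i
  calc _ ≤ _ := Set.ncard_le_ncard hsub (Finset.finite_toSet _)
    _ = _ := Set.ncard_coe_finset _
    _ ≤ _ := Finset.card_insert_le _ _
    _ ≤ _ := by gcongr; exact Finset.card_image_le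

/-! ### Offsets that turn a gap into a long jump. -/

open Classical in
/-- A bound for the number of offsets for which a gap with `n` interior points is a long jump. -/
noncomputable def crossBound (L : ℕ) (t : ℝ) (n : ℕ) : ℝ :=
  if (t - 1) * L < (n : ℝ) + 1 then min (L : ℝ) (n + 1) else 0

theorem crossBound_nonneg (L : ℕ) (t : ℝ) (n : ℕ) : 0 ≤ crossBound L t n := by
  unfold crossBound
  split_ifs <;> positivity

open Classical in
theorem card_crossing_le {L : ℕ} (hL : 0 < L) {t : ℝ} (ht : 1 ≤ t) {x y : ℕ} (hxy : x < y) :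
    (((Finset.Icc 1 L).filter fun Δ =>
      t ≤ ((intervalIndex L Δ y - intervalIndex L Δ x : ℤ) : ℝ)).card : ℝ) ≤
      crossBound L t (y - x - 1) := by
  have hL' : (0 : ℤ) < L := by exact_mod_cast hL
  have hd : (((y - x - 1 : ℕ) : ℝ) + 1) = (y : ℝ) - x := by
    rw [Nat.sub_sub, Nat.cast_sub (by omega)]; push_cast; ring
  set F := (Finset.Icc 1 L).filter fun Δ =>
      t ≤ ((intervalIndex L Δ y - intervalIndex L Δ x : ℤ) : ℝ) with hF
  unfold crossBound
  rw [hd]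
  split_ifs with h
  · refine le_min ?_ ?_
    · have : F.card ≤ (Finset.Icc 1 L).card := Finset.card_filter_le _ _
      rw [Nat.card_Icc] at this
      exact_mod_cast this
    · have hc : F.card ≤ (Finset.Ioc (x : ℤ) y).card := by
        -- Send `Δ` to the left end of the interval containing `y`. A jump puts it in `(x, y]`, and
        -- its residue modulo `L` recovers `Δ`.
        refine Finset.card_le_card_of_injOn (fun Δ : ℕ => (Δ : ℤ) + L * intervalIndex L Δ y) ?_ ?_
        · intro Δ hΔ
          obtain ⟨-, h2⟩ := Finset.mem_filter.1 (Finset.mem_coe.1 hΔ)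
          have h3 : intervalIndex L Δ x < intervalIndex L Δ y := by
            have : (1 : ℝ) ≤ ((intervalIndex L Δ y - intervalIndex L Δ x : ℤ) : ℝ) := ht.trans h2
            have : 1 ≤ intervalIndex L Δ y - intervalIndex L Δ x := by exact_mod_cast this
            omega
          rw [Finset.mem_coe, Finset.mem_Ioc]
          have h4 : L * intervalIndex L Δ y ≤ (y : ℤ) - Δ := Int.mul_ediv_self_le hL'.ne'
          have h5 := (Int.ediv_lt_iff_lt_mul hL').1 h3
          constructor <;> linarith
        · intro Δ hΔ Δ' hΔ' he
          simp only at he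
          obtain ⟨h1, -⟩ := Finset.mem_filter.1 (Finset.mem_coe.1 hΔ)
          obtain ⟨h2, -⟩ := Finset.mem_filter.1 (Finset.mem_coe.1 hΔ')
          rw [Finset.mem_Icc] at h1 h2
          have hdvd : (L : ℤ) ∣ (Δ : ℤ) - Δ' :=
            ⟨intervalIndex L Δ' y - intervalIndex L Δ y, by linarith⟩
          have := Int.eq_zero_of_abs_lt_dvd hdvd (abs_lt.2 ⟨by omega, by omega⟩)
          omega
      rw [Int.card_Ioc] at hc
      have : ((F.card : ℕ) : ℤ) ≤ (y : ℤ) - x := by omega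
      have : (F.card : ℝ) ≤ ((y : ℤ) - x : ℤ) := by exact_mod_cast this
      simpa using this
  · refine le_of_eq ?_
    rw [Nat.cast_eq_zero, Finset.card_eq_zero, hF, Finset.filter_eq_empty_iff]
    intro Δ _ h2
    apply h
    have h4 : L * intervalIndex L Δ y ≤ (y : ℤ) - Δ := Int.mul_ediv_self_le hL'.ne'
    have h5 : (x : ℤ) - Δ < L * intervalIndex L Δ x + L := Int.lt_mul_ediv_self_add hL'
    have h6 : (L : ℝ) * ((intervalIndex L Δ y - intervalIndex L Δ x : ℤ) : ℝ) < y - x + L := by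
      have : (L : ℤ) * (intervalIndex L Δ y - intervalIndex L Δ x) < y - x + L := by linarith
      exact_mod_cast this
    have hLr : (0 : ℝ) < L := by exact_mod_cast hL
    nlinarith

/-! ### Summation against the `3/2`-power law. -/

/-- Makes the tail sum telescope; `6` comes from `√(d+1) ≤ 2√d` in `√d √(d+1) (√d + √(d+1))`. -/
theorem inv_mul_sqrt_le {d : ℝ} (hd : 1 ≤ d) :
    1 / (d * √d) ≤ 6 * (1 / √d - 1 / √(d + 1)) := by
  have hu : 0 < √d := Real.sqrt_pos.2 (by linarith)
  have hv : 0 < √(d + 1) := Real.sqrt_pos.2 (by linarith)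
  have hu2 : √d ^ 2 = d := Real.sq_sqrt (by linarith)
  have hv2 : √(d + 1) ^ 2 = d + 1 := Real.sq_sqrt (by linarith)
  have hvu : √(d + 1) ≤ 2 * √d := by
    refine (sq_le_sq₀ hv.le (by positivity)).1 ?_
    rw [mul_pow, hu2, hv2]
    linarith
  set u := √d
  set v := √(d + 1)
  have e : 1 / u - 1 / v = 1 / (u * v * (u + v)) := by
    field_simp
    linear_combination hv2 - hu2
  have e2 : d * u = u * u * u := by rw [← hu2]; ring
  have hle : u * v * (u + v) ≤ 6 * (u * u * u) :=
    calc u * v * (u + v) ≤ u * (2 * u) * (u + 2 * u) := by gcongr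
      _ = _ := by ring
  rw [e, e2, mul_one_div, div_le_div_iff₀ (by positivity) (by positivity)]
  linarith

open Classical in
theorem sum_tail_le {x : ℝ} (hx : 0 < x) (M : ℕ) :
    ∑ n ∈ Finset.range M, (if x < (n : ℝ) + 1 then 1 / (((n : ℝ) + 1) * √(n + 1)) else 0) ≤
      6 / √x := by
  -- The `max` freezes `f` below the cutoff, so omitted terms still have nonnegative differences.
  set f : ℕ → ℝ := fun n => 6 / √(max x (n + 1)) with hf
  calc _ ≤ ∑ n ∈ Finset.range M, (f n - f (n + 1)) := by
        refine Finset.sum_le_sum fun n _ => ?_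
        have hn : (0 : ℝ) ≤ n := n.cast_nonneg
        simp only [hf]
        split_ifs with h
        · rw [max_eq_right h.le, max_eq_right (by push_cast; linarith)]
          refine (inv_mul_sqrt_le (by linarith)).trans (le_of_eq ?_)
          push_cast
          ring
        · rw [sub_nonneg]
          have : 0 < √(max x ((n : ℝ) + 1)) := Real.sqrt_pos.2 (lt_max_of_lt_left hx)
          gcongr
          simp
    _ = f 0 - f M := Finset.sum_range_sub' _ _
    _ ≤ f 0 := sub_le_self _ (by positivity)
    _ ≤ 6 / √x := by
        have : 0 < √x := Real.sqrt_pos.2 hx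
        simp only [hf]
        gcongr
        exact le_max_left _ _

open Classical in
theorem sum_inv_sqrt_le (x : ℝ) (M : ℕ) :
    ∑ n ∈ Finset.range M, (if (n : ℝ) + 1 ≤ x then 1 / √((n : ℝ) + 1) else 0) ≤ 2 * √x := by
  set f : ℕ → ℝ := fun n => 2 * √(min x n) with hf
  calc _ ≤ ∑ n ∈ Finset.range M, (f (n + 1) - f n) := by
        refine Finset.sum_le_sum fun n _ => ?_
        have hn : (0 : ℝ) ≤ n := n.cast_nonneg
        simp only [hf]
        split_ifs with h
        · rw [min_eq_right (by push_cast; linarith), min_eq_right (by linarith)]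
          push_cast
          have hv : 0 < √((n : ℝ) + 1) := Real.sqrt_pos.2 (by linarith)
          have hu2 : √(n : ℝ) ^ 2 = n := Real.sq_sqrt (by linarith)
          have hv2 : √((n : ℝ) + 1) ^ 2 = n + 1 := Real.sq_sqrt (by linarith)
          rw [div_le_iff₀ hv]
          nlinarith [sq_nonneg (√((n : ℝ) + 1) - √n)]
        · rw [sub_nonneg]
          gcongr
          linarith
    _ = f M - f 0 := Finset.sum_range_sub _ _
    _ ≤ f M := sub_le_self _ (by positivity)
    _ ≤ 2 * √x := by
        simp only [hf]
        gcongr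
        exact min_le_left _ _

theorem sum_crossBound_le {L : ℕ} (hL : 0 < L) {t : ℝ} (ht : 1 ≤ t) (M : ℕ) :
    ∑ n ∈ Finset.range M, crossBound L t n / (((n : ℝ) + 1) * √(n + 1)) ≤ 12 * √(L / t) := by
  classical
  have hLr : (0 : ℝ) < L := by exact_mod_cast hL
  have ht0 : 0 < t := by linarith
  have hsq : ∀ x : ℝ, 0 < x → x / √x = √x := fun x hx => Real.div_sqrt
  rcases le_or_gt 2 t with h2 | h2
  -- For `t ≥ 2`, `(t-1)L > tL/4`, and only the tail above this cutoff counts.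
  · have hx : 0 < t * L / 4 := by positivity
    calc _ ≤ ∑ n ∈ Finset.range M,
          L * (if t * L / 4 < (n : ℝ) + 1 then 1 / (((n : ℝ) + 1) * √(n + 1)) else 0) := by
          refine Finset.sum_le_sum fun n _ => ?_
          unfold crossBound
          split_ifs with h h' h'
          · rw [mul_one_div]
            gcongr
            exact min_le_left _ _
          · nlinarith
          · simp only [zero_div]; positivity
          · simp
      _ = L * ∑ n ∈ Finset.range M,
          (if t * L / 4 < (n : ℝ) + 1 then 1 / (((n : ℝ) + 1) * √(n + 1)) else 0) := by
          rw [Finset.mul_sum]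
      _ ≤ L * (6 / √(t * L / 4)) := by gcongr; exact sum_tail_le hx M
      _ = 12 * √(L / t) := by
          have h4 : √(4 : ℝ) = 2 := by rw [show (4 : ℝ) = 2 ^ 2 by norm_num]; simp
          rw [Real.sqrt_div (by positivity), Real.sqrt_mul ht0.le, Real.sqrt_div hLr.le, h4]
          have h5 : √(L : ℝ) * √(L : ℝ) = L := Real.mul_self_sqrt hLr.le
          have h6 : 0 < √(L : ℝ) := Real.sqrt_pos.2 hLr
          have h7 : 0 < √t := Real.sqrt_pos.2 ht0
          field_simp
          linear_combination -12 * h5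
  -- For `t < 2` use `min(L, n+1)`, split at `n + 1 = L`; the resulting `8√L` is at most `12√(L/t)`
  -- since `64 * 2 ≤ 144`.
  · calc _ ≤ ∑ n ∈ Finset.range M,
          ((if (n : ℝ) + 1 ≤ L then 1 / √((n : ℝ) + 1) else 0) +
          L * (if (L : ℝ) < (n : ℝ) + 1 then 1 / (((n : ℝ) + 1) * √(n + 1)) else 0)) := by
          refine Finset.sum_le_sum fun n _ => ?_
          have hn : (0 : ℝ) < (n : ℝ) + 1 := by positivity
          have hb1 : crossBound L t n ≤ L := by
            unfold crossBound; split_ifs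
            · exact min_le_left _ _
            · exact hLr.le
          have hb2 : crossBound L t n ≤ n + 1 := by
            unfold crossBound; split_ifs
            · exact min_le_right _ _
            · exact hn.le
          rcases le_or_gt ((n : ℝ) + 1) L with h | h
          · rw [if_pos h, if_neg (not_lt.2 h), mul_zero, add_zero]
            calc _ ≤ ((n : ℝ) + 1) / (((n : ℝ) + 1) * √(n + 1)) := by gcongr
              _ = _ := by field_simp
          · rw [if_neg (not_le.2 h), if_pos h, zero_add, mul_one_div]
            gcongr
      _ ≤ 2 * √(L : ℝ) + L * (6 / √(L : ℝ)) := by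
          rw [Finset.sum_add_distrib, ← Finset.mul_sum]
          gcongr
          · exact sum_inv_sqrt_le L M
          · exact sum_tail_le hLr M
      _ = 8 * √(L : ℝ) := by
          have := hsq L hLr
          linear_combination 6 * this
      _ ≤ 12 * √(L / t) := by
          refine (sq_le_sq₀ (by positivity) (by positivity)).1 ?_
          rw [mul_pow, mul_pow, Real.sq_sqrt hLr.le, Real.sq_sqrt (by positivity)]
          rw [← mul_div_assoc, le_div_iff₀ ht0]
          nlinarith

end CatalanBlock

/-! ### The law of one gap and the expected number of long jumps. -/

namespace CatalanBlock

theorem mk_catalan_eq : (PowerSeries.mk fun n => (catalan n : ℝ)) =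
    PowerSeries.map (Nat.castRingHom ℝ) PowerSeries.catalanSeries := by
  ext n
  simp

theorem coeff_mk_catalan_pow (r n : ℕ) :
    PowerSeries.coeff n ((PowerSeries.mk fun n => (catalan n : ℝ)) ^ r) = ballot r n := by
  rw [mk_catalan_eq, ← map_pow, PowerSeries.coeff_map, ballot]
  simp

theorem totalWeight_eq {U m : ℕ} (h : m ≤ U) : (totalWeight U m : ℝ) = ballot (m + 1) (U - m) := by
  have h1 := sum_pointSeqs_prod h fun _ n => (catalan n : ℝ)
  rw [Finset.prod_const, Finset.card_univ, Fintype.card_fin, coeff_mk_catalan_pow] at h1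
  rw [← h1, totalWeight]
  push_cast [gapWeight]
  rfl

/-- The law of a single gap, before normalization. -/
theorem sum_gapWeight_mul {U m : ℕ} (h : m ≤ U) (j : Fin (m + 1)) (H : ℕ → ℝ) :
    ∑ s ∈ pointSeqs U m, (gapWeight s : ℝ) * H (gaps s j) =
      ∑ q ∈ Finset.HasAntidiagonal.antidiagonal (U - m), catalan q.1 * H q.1 * ballot m q.2 := by
  have h1 := sum_pointSeqs_prod h fun i n => (catalan n : ℝ) * if i = j then H n else 1
  have h2 : ∏ i, PowerSeries.mk (fun n => (catalan n : ℝ) * if i = j then H n else 1) =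
      PowerSeries.mk (fun n => (catalan n : ℝ) * H n) *
        (PowerSeries.mk fun n => (catalan n : ℝ)) ^ m := by
    rw [← Finset.mul_prod_erase Finset.univ _ (Finset.mem_univ j)]
    congr 1
    · simp
    · rw [Finset.prod_congr rfl (g := fun _ => PowerSeries.mk fun n => (catalan n : ℝ))]
      · simp
      · intro i hi
        simp [Finset.ne_of_mem_erase hi]
  rw [h2, PowerSeries.coeff_mul] at h1
  simp only [coeff_mk_catalan_pow, PowerSeries.coeff_mk] at h1
  rw [← h1]
  refine Finset.sum_congr rfl fun s _ => ?_
  rw [Finset.prod_mul_distrib]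
  simp only [Finset.prod_ite_eq', Finset.mem_univ, if_true]
  push_cast [gapWeight]
  rfl

theorem sum_card_longJumps_le {L U m : ℕ} (hL : 0 < L) {t : ℝ} (ht : 1 ≤ t)
    {s : Fin (m + 2) → Fin (U + 2)} (hs : s ∈ pointSeqs U m) :
    ∑ Δ ∈ Finset.Icc 1 L, ((longJumps L Δ t s).card : ℝ) ≤
      ∑ j, crossBound L t (gaps s j) := by
  classical
  simp only [longJumps, Finset.card_filter, Nat.cast_sum]
  rw [Finset.sum_comm]
  refine Finset.sum_le_sum fun j _ => ?_
  simp only [pointSeqs, Finset.mem_filter, Finset.mem_univ, true_and] at hs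
  have h := card_crossing_le hL ht
    (show (s j.castSucc : ℕ) < s j.succ from hs.1 Fin.castSucc_lt_succ)
  rw [Finset.card_filter, Nat.cast_sum] at h
  exact h

/-- Bounding the other `m` gaps uniformly leaves a one-variable sum, with `768 = 64 * 12`. The
factor `m^2` cancels against that in the lower bound for the normalizing constant. -/
theorem sum_gapWeight_mul_crossBound_le {L U m : ℕ} (hL : 0 < L) (hm : 1 ≤ m) (h : m ≤ U) {t : ℝ}
    (ht : 1 ≤ t) (j : Fin (m + 1)) :
    (∑ s ∈ pointSeqs U m, (gapWeight s : ℝ) * crossBound L t (gaps s j)) * m ^ 2 ≤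
      768 * 2 ^ (2 * (U - m) + (m + 1)) * √(L / t) := by
  rw [sum_gapWeight_mul h, Finset.sum_mul]
  calc _ ≤ ∑ q ∈ Finset.HasAntidiagonal.antidiagonal (U - m), 64 * 2 ^ (2 * (U - m) + (m + 1)) *
        (crossBound L t q.1 / (((q.1 : ℝ) + 1) * √(q.1 + 1))) := by
        refine Finset.sum_le_sum fun q hq => ?_
        rw [Finset.HasAntidiagonal.mem_antidiagonal] at hq
        have hc := catalan_le q.1
        have hb := ballot_mul_sq_le m q.2
        have hH := crossBound_nonneg L t q.1
        have he : 2 * (U - m) + (m + 1) = (2 * q.1 + 1) + (2 * q.2 + m) := by omega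
        have hb0 : 0 ≤ ballot m q.2 * m ^ 2 := by unfold ballot; positivity
        calc catalan q.1 * crossBound L t q.1 * ballot m q.2 * m ^ 2
            = catalan q.1 * crossBound L t q.1 * (ballot m q.2 * m ^ 2) := by ring
          _ ≤ (2 ^ (2 * q.1 + 1) / (((q.1 : ℝ) + 1) * √(q.1 + 1))) * crossBound L t q.1 *
              (64 * 2 ^ (2 * q.2 + m)) := by gcongr
          _ = _ := by rw [he, pow_add _ (2 * q.1 + 1)]; ring
    _ = 64 * 2 ^ (2 * (U - m) + (m + 1)) * ∑ n ∈ Finset.range (U - m + 1),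
        crossBound L t n / (((n : ℝ) + 1) * √(n + 1)) := by
        rw [← Finset.mul_sum, Finset.Nat.sum_antidiagonal_eq_sum_range_succ_mk]
    _ ≤ 64 * 2 ^ (2 * (U - m) + (m + 1)) * (12 * √(L / t)) := by
        gcongr
        exact sum_crossBound_le hL ht _
    _ = _ := by ring

/-- The expected number of long jumps. -/
theorem exists_sum_longJumps_le (a b : ℝ) (ha : 0 < a) (hb : 0 < b) :
    ∃ C : ℝ, 0 < C ∧ ∀ (m U L : ℕ) (k t : ℝ), 1 ≤ m → m ≤ U → a * (m : ℝ) ^ 2 ≤ U →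
      (U : ℝ) ≤ b * (m : ℝ) ^ 2 → 0 < k → 0 < L → (m : ℝ) ^ 2 ≤ 2 * k * L → 1 ≤ t →
      ∑ s ∈ pointSeqs U m, ∑ Δ ∈ Finset.Icc 1 L,
        seqProb s * (1 / (L : ℝ)) * ((longJumps L Δ t s).card : ℝ) ≤ C * √(k / t) := by
  obtain ⟨c, hc, hlow⟩ := exists_le_ballot a b ha hb
  -- One factor `2` is from `m + 1 ≤ 2m`, the other from `hsqrt`.
  refine ⟨4 * 768 / c, by positivity, ?_⟩
  intro m U L k t hm hmU h1 h2 hk hL hmL ht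
  have hlow := hlow m U hm hmU h1 h2
  rw [← totalWeight_eq hmU] at hlow
  have hLr : (0 : ℝ) < L := by exact_mod_cast hL
  have hm1 : (1 : ℝ) ≤ m := by exact_mod_cast hm
  have ht0 : 0 < t := by linarith
  have hW : (0 : ℝ) < totalWeight U m := by exact_mod_cast totalWeight_pos hmU
  set W : ℝ := (totalWeight U m : ℝ) with hWdef
  set P : ℝ := 2 ^ (2 * (U - m) + (m + 1)) with hP
  have hP0 : 0 < P := by positivity
  have hgap : ∀ j : Fin (m + 1),
      ∑ s ∈ pointSeqs U m, (gapWeight s : ℝ) * crossBound L t (gaps s j) ≤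
        768 / c * W * √(L / t) := by
    intro j
    have hj := sum_gapWeight_mul_crossBound_le hL hm hmU ht j
    rw [← hP] at hj
    have hm2 : (0 : ℝ) < (m : ℝ) ^ 2 := by positivity
    refine le_of_mul_le_mul_right (hj.trans ?_) hm2
    have : P ≤ W * m ^ 2 / c := by rw [le_div_iff₀ hc]; linarith
    calc 768 * P * √(L / t) ≤ 768 * (W * m ^ 2 / c) * √(L / t) := by gcongr
      _ = _ := by ring
  have hsqrt : m * √(L / t) ≤ 2 * L * √(k / t) := by
    refine (sq_le_sq₀ (by positivity) (by positivity)).1 ?_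
    rw [mul_pow, mul_pow, Real.sq_sqrt (by positivity), Real.sq_sqrt (by positivity)]
    rw [← mul_div_assoc, ← mul_div_assoc]
    refine div_le_div_of_nonneg_right ?_ ht0.le
    nlinarith [mul_le_mul_of_nonneg_right hmL hLr.le, mul_pos hk (mul_pos hLr hLr)]
  calc ∑ s ∈ pointSeqs U m, ∑ Δ ∈ Finset.Icc 1 L,
        seqProb s * (1 / (L : ℝ)) * ((longJumps L Δ t s).card : ℝ)
      ≤ ∑ s ∈ pointSeqs U m, 1 / (L * W) *
          ∑ j, (gapWeight s : ℝ) * crossBound L t (gaps s j) := by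
        refine Finset.sum_le_sum fun s hs => ?_
        rw [← Finset.mul_sum, ← Finset.mul_sum, ← mul_assoc]
        have := sum_card_longJumps_le hL ht hs
        calc _ ≤ seqProb s * (1 / (L : ℝ)) * ∑ j, crossBound L t (gaps s j) := by
              have : 0 ≤ seqProb s := by unfold seqProb; positivity
              gcongr
          _ = _ := by rw [seqProb, ← hWdef]; field_simp
    _ = 1 / (L * W) * ∑ j : Fin (m + 1),
          ∑ s ∈ pointSeqs U m, (gapWeight s : ℝ) * crossBound L t (gaps s j) := by
        rw [← Finset.mul_sum, Finset.sum_comm]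
    _ ≤ 1 / (L * W) * ∑ _j : Fin (m + 1), 768 / c * W * √(L / t) := by
        gcongr with j
        exact hgap j
    _ = 768 / c / L * ((m + 1) * √(L / t)) := by
        rw [Finset.sum_const, Finset.card_univ, Fintype.card_fin, nsmul_eq_mul]
        push_cast
        field_simp
    _ ≤ 768 / c / L * (2 * (m * √(L / t))) := by
        rw [← mul_assoc 2]
        gcongr
        linarith
    _ ≤ 768 / c / L * (2 * (2 * L * √(k / t))) := by gcongr
    _ = _ := by field_simp; ring

theorem expect_mono {U m L : ℕ} {f : Finset ℕ → ℕ → ℝ} {g : (Fin (m + 2) → Fin (U + 2)) → ℕ → ℝ}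
    (h : ∀ s ∈ pointSeqs U m, ∀ Δ, f (pointSet s) Δ ≤ g s Δ) :
    expect U m L f ≤
      ∑ s ∈ pointSeqs U m, ∑ Δ ∈ Finset.Icc 1 L, seqProb s * (1 / (L : ℝ)) * g s Δ := by
  refine Finset.sum_le_sum fun s hs => Finset.sum_le_sum fun Δ _ => ?_
  have : 0 ≤ seqProb s := by unfold seqProb; positivity
  gcongr
  exact h s hs Δ

end CatalanBlock

/-! ### The two bounds. -/

theorem mainTheorem5 (a b : ℝ) (ha : 0 < a) (hb : 0 < b) :
    ∃ C : ℝ, 0 < C ∧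
      ∀ (m U : ℕ) (k : ℝ), 1 ≤ k → k ≤ (m : ℝ) ^ 2 → m ≤ U →
        a * (m : ℝ) ^ 2 ≤ (U : ℝ) → (U : ℝ) ≤ b * (m : ℝ) ^ 2 →
        ∀ L K : ℕ, L = ⌊(m : ℝ) ^ 2 / k⌋₊ → K = U / L →
          (∀ t : ℝ, 1 ≤ t →
            CatalanBlock.expect U m L
                (fun S Δ => ((CatalanBlock.gapPairs L S Δ t).ncard : ℝ)) ≤
              C * (Real.sqrt (k / t) + 1)) ∧
          CatalanBlock.expect U m L
              (fun S Δ => ((CatalanBlock.nonemptyIntervals L S Δ).ncard : ℝ)) ≤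
            C * (Real.sqrt k + Real.log K) := by
  obtain ⟨C, hC, hmain⟩ := CatalanBlock.exists_sum_longJumps_le a b ha hb
  -- The extra `1` absorbs the interval of `s_0`, since `√k ≥ 1`.
  refine ⟨C + 1, by positivity, ?_⟩
  intro m U k hk1 hkm hmU h1 h2 L K hLdef _
  have hk0 : 0 < k := by linarith
  have hm : 1 ≤ m := by
    rcases Nat.eq_zero_or_pos m with rfl | h
    · norm_num at hkm; linarith
    · exact h
  have hq : 1 ≤ (m : ℝ) ^ 2 / k := (one_le_div hk0).2 hkm
  have hL : 0 < L := hLdef ▸ Nat.floor_pos.2 hq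
  have hL1 : (1 : ℝ) ≤ L := by exact_mod_cast hL
  -- Rounding costs a factor `2`: `m^2/k < L + 1 ≤ 2L`.
  have hmL : (m : ℝ) ^ 2 ≤ 2 * k * L := by
    have h3 : (m : ℝ) ^ 2 / k < L + 1 := hLdef ▸ Nat.lt_floor_add_one _
    rw [div_lt_iff₀ hk0] at h3
    nlinarith
  have hmain := fun t => hmain m U L k t hm hmU h1 h2 hk0 hL hmL
  constructor
  · intro t ht
    have h4 := CatalanBlock.expect_mono (U := U) (m := m) (L := L)
      (f := fun S Δ => ((CatalanBlock.gapPairs L S Δ t).ncard : ℝ))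
      fun s hs Δ => Nat.cast_le.2 (CatalanBlock.ncard_gapPairs_le hL Δ t hs)
    have h5 := hmain t ht
    have h6 := Real.sqrt_nonneg (k / t)
    nlinarith
  · have h4 := CatalanBlock.expect_mono (U := U) (m := m) (L := L)
      (f := fun S Δ => ((CatalanBlock.nonemptyIntervals L S Δ).ncard : ℝ))
      fun s hs Δ => Nat.cast_le.2 (CatalanBlock.ncard_nonemptyIntervals_le hL Δ hs)
    have h5 := hmain 1 le_rfl
    have h6 := CatalanBlock.expect_one hmU hL
    simp only [CatalanBlock.expect, mul_one] at h6
    simp only [Nat.cast_add, Nat.cast_one, mul_add, mul_one, Finset.sum_add_distrib] at h4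
    rw [div_one] at h5
    have h7 : 1 ≤ √k := Real.one_le_sqrt.2 hk1
    have h8 : 0 ≤ Real.log K := Real.log_natCast_nonneg K
    nlinarith [mul_nonneg hC.le h8]
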